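/- PHOML is the following type theory. Fix three disjoint infinite sets of variables: term variables $x,y$, proof variables $p$ and path variables $e$. Its syntax is $$\begin{array}{lrcl} \text{Types} & A,B &::=& \Omega \mid A\to B\\ \text{Terms} & M,N,\varphi,\psi &::=& x\mid\bot\mid\varphi\supset\psi\mid\lambda x{:}A.M\mid MN\\ \text{Proofs} & \delta,\epsilon &::=& p\mid\lambda p{:}\varphi.\delta\mid\delta\epsilon\mid P^+\mid P^-\\ \text{Paths} & P,Q &::=& e\mid \mathsf{ref}(M)\mid P\supset^*Q\mid \mathsf{univ}_{\varphi,\psi}(\delta,\epsilon)\mid \lambda\!\!\lambda\!\!\lambda e{:}x=_Ay.P\mid P_{MN}Q\\ \text{Contexts} & \Gamma &::=& \langle\rangle\mid\Gamma,x{:}A\mid\Gamma,p{:}\varphi\mid\Gamma,e{:}M=_AN \end{array}$$ up to renaming of bound variables, where $\lambda x{:}A.M$ binds $x$ in $M$, $\lambda p{:}\varphi.\delta$ binds $p$ in $\delta$, and $\lambda\!\!\lambda\!\!\lambda e{:}x=_Ay.P$ (with $x\ne y$) binds $e,x,y$ in $P$; the variables declared in a context are distinct. Convertibility $\simeq$ of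 terms is the reflexive symmetric transitive closure of the relation $\to$ generated by $(\lambda x{:}A.M)N\to M[x:=N]$, by $MN\to M'N$ when $M\to M'$, and by $\varphi\supset\psi\to\varphi'\supset\psi$ when $\varphi\to\varphi'$ and $\varphi\supset\psi\to\varphi\supset\psi'$ when $\psi\to\psi'$. The judgements $\Gamma\vdash\mathrm{valid}$, $\Gamma\vdash M:A$, $\Gamma\vdash\delta:\varphi$ and $\Gamma\vdash P:M=_AN$ are those derivable by the following rules. Contexts and variables: - $\langle\rangle\vdash\mathrm{valid}$. - If $\Gamma\vdash\mathrm{valid}$, then $\Gamma,x{:}A\vdash\mathrm{valid}$. - If $\Gamma\vdash\varphi:\Omega$, then $\Gamma,p{:}\varphi\vdash\mathrm{valid}$. - If $\Gamma\vdash M:A$ and $\Gamma\vdash N:A$, then $\Gamma,e{:}M=_AN\vdash\mathrm{valid}$. - If $\Gamma\vdash\mathrm{valid}$, then $\Gamma\vdash x:A$, $\Gamma\vdash p:\varphi$ and $\Gamma\vdash e:M=_AN$ for all entries $x{:}A$, $p{:}\varphi$ and $e{:}M=_AN$ of $\Gamma$. Terms: - If $\Gamma\vdash\mathrm{valid}$,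 then $\Gamma\vdash\bot:\Omega$. - If $\Gamma\vdash\varphi:\Omega$ and $\Gamma\vdash\psi:\Omega$, then $\Gamma\vdash\varphi\supset\psi:\Omega$. - If $\Gamma\vdash M:A\to B$ and $\Gamma\vdash N:A$, then $\Gamma\vdash MN:B$. - If $\Gamma,x{:}A\vdash M:B$, then $\Gamma\vdash\lambda x{:}A.M:A\to B$. Proofs: - If $\Gamma\vdash\delta:\varphi\supset\psi$ and $\Gamma\vdash\epsilon:\varphi$, then $\Gamma\vdash\delta\epsilon:\psi$. - If $\Gamma,p{:}\varphi\vdash\delta:\psi$, then $\Gamma\vdash\lambda p{:}\varphi.\delta:\varphi\supset\psi$. - If $\Gamma\vdash\delta:\varphi$, $\Gamma\vdash\psi:\Omega$ and $\varphi\simeq\psi$, then $\Gamma\vdash\delta:\psi$. - If $\Gamma\vdash P:\varphi=_\Omega\psi$, then $\Gamma\vdash P^+:\varphi\supset\psi$ and $\Gamma\vdash P^-:\psi\supset\varphi$. Paths: - If $\Gamma\vdash M:A$, then $\Gamma\vdash\mathsf{ref}(M):M=_AM$. - If $\Gamma\vdash P:\varphi=_\Omega\varphi'$ and $\Gamma\vdash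 Q:\psi=_\Omega\psi'$, then $\Gamma\vdash P\supset^*Q:(\varphi\supset\psi)=_\Omega(\varphi'\supset\psi')$. - If $\Gamma\vdash\delta:\varphi\supset\psi$ and $\Gamma\vdash\epsilon:\psi\supset\varphi$, then $\Gamma\vdash\mathsf{univ}_{\varphi,\psi}(\delta,\epsilon):\varphi=_\Omega\psi$. - If $\Gamma,x{:}A,y{:}A,e{:}x=_Ay\vdash P:Mx=_BNy$, $\Gamma\vdash M:A\to B$ and $\Gamma\vdash N:A\to B$, then $\Gamma\vdash\lambda\!\!\lambda\!\!\lambda e{:}x=_Ay.P:M=_{A\to B}N$. - If $\Gamma\vdash P:M=_{A\to B}M'$, $\Gamma\vdash Q:N=_AN'$, $\Gamma\vdash N:A$ and $\Gamma\vdash N':A$, then $\Gamma\vdash P_{NN'}Q:MN=_BM'N'$. - If $\Gamma\vdash P:M=_AN$, $\Gamma\vdash M':A$, $\Gamma\vdash N':A$, $M\simeq M'$ and $N\simeq N'$, then $\Gamma\vdash P:M'=_AN'$. **Corollary (Consistency).** There is no proof $\delta$ such that $\langle\rangle\vdash\delta:\bot$ is derivable in PHOML. -/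

import Mathlib

/-! PHOML: syntax (in de Bruijn form, with separate indices for term, proof and path variables,
which identifies expressions up to renaming of bound variables), convertibility of terms, and the
rules of deduction. -/

namespace PHOML

/-- Types: the simple types over `Ω`. -/
inductive Ty : Type
  | Omega : Ty
  | arrow : Ty → Ty → Ty

/-- Terms: `x`, `⊥`, `φ ⊃ ψ`, `λ x : A. M`, `M N`.
The constructor `lam` binds the term variable `0` in its body. -/
inductive Term : Type
  | var : ℕ → Term
  | bot : Term
  | imp : Term → Term → Term
  | lam : Ty → Term → Term
  | app : Term → Term → Term

mutual

/-- Proofs: `p`, `λ p : φ. δ`, `δ ε`, `P⁺`, `P⁻`.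
The constructor `lam` binds the proof variable `0` in its body. -/
inductive Proof : Type
  | var : ℕ → Proof
  | lam : Term → Proof → Proof
  | app : Proof → Proof → Proof
  | plus : Path → Proof
  | minus : Path → Proof

/-- Paths: `e`, `ref M`, `P ⊃* Q`, `univ_{φ,ψ}(δ, ε)`, `λλλ e : x =_A y. P`, `P_{MN} Q`.
The constructor `tlam A P` binds in `P` the path variable `e = 0` and the two term variables
`x = 1` and `y = 0`; `app P M N Q` is `P_{MN} Q`. -/
inductive Path : Type
  | var : ℕ → Path
  | ref : Term → Path
  | imp : Path → Path → Path
  | univ : Term → Term → Proof → Proof → Path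
  | tlam : Ty → Path → Path
  | app : Path → Term → Term → Path → Path

end

namespace Term

/-- Extension of a renaming of term variables under a binder. -/
def upRen (ξ : ℕ → ℕ) : ℕ → ℕ
  | 0 => 0
  | n + 1 => ξ n + 1

/-- Renaming of the free term variables of a term. -/
def rename : (ℕ → ℕ) → Term → Term
  | ξ, var n => var (ξ n)
  | _, bot => bot
  | ξ, imp φ ψ => imp (rename ξ φ) (rename ξ ψ)
  | ξ, lam A M => lam A (rename (upRen ξ) M)
  | ξ, app M N => app (rename ξ M) (rename ξ N)

/-- Weakening of a term by one fresh term variable. -/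
def shift (M : Term) : Term := rename Nat.succ M

/-- Extension of a substitution of terms for term variables under a binder. -/
def upSubst (σ : ℕ → Term) : ℕ → Term
  | 0 => var 0
  | n + 1 => shift (σ n)

/-- Simultaneous capture-avoiding substitution of terms for term variables. -/
def subst : (ℕ → Term) → Term → Term
  | σ, var n => σ n
  | _, bot => bot
  | σ, imp φ ψ => imp (subst σ φ) (subst σ ψ)
  | σ, lam A M => lam A (subst (upSubst σ) M)
  | σ, app M N => app (subst σ M) (subst σ N)

/-- The substitution `[x := N]` where `x` is the variable `0`; the other variables are
lowered by one. -/
def single (N : Term) : ℕ → Term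
  | 0 => N
  | n + 1 => var n

/-- `M [x := N]`, where `x` is the variable `0` of `M`. -/
def inst (M N : Term) : Term := subst (single N) M

/-- Call-by-name reduction `M → N` on terms. -/
inductive Red : Term → Term → Prop
  | beta (A : Ty) (M N : Term) : Red (app (lam A M) N) (inst M N)
  | appLeft {M M' : Term} (N : Term) : Red M M' → Red (app M N) (app M' N)
  | impLeft {φ φ' : Term} (ψ : Term) : Red φ φ' → Red (imp φ ψ) (imp φ' ψ)
  | impRight (φ : Term) {ψ ψ' : Term} : Red ψ ψ' → Red (imp φ ψ) (imp φ ψ')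

/-- Convertibility `M ≃ N`: the reflexive symmetric transitive closure of reduction. -/
def Conv (M N : Term) : Prop := Relation.EqvGen Red M N

end Term

/-- Contexts: `⟨⟩`, `Γ, x : A`, `Γ, p : φ`, `Γ, e : M =_A N`.
The last declared variable of each of the three kinds has index `0`. -/
inductive Ctx : Type
  | nil : Ctx
  | snocT : Ctx → Ty → Ctx
  | snocP : Ctx → Term → Ctx
  | snocE : Ctx → Term → Ty → Term → Ctx

namespace Ctx

/-- `x : A ∈ Γ` for the term variable with index `n`. -/
inductive MemT : Ctx → ℕ → Ty → Prop
  | here (Γ : Ctx) (A : Ty) : MemT (snocT Γ A) 0 A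
  | skipT {Γ : Ctx} {n : ℕ} {A : Ty} (B : Ty) : MemT Γ n A → MemT (snocT Γ B) (n + 1) A
  | skipP {Γ : Ctx} {n : ℕ} {A : Ty} (φ : Term) : MemT Γ n A → MemT (snocP Γ φ) n A
  | skipE {Γ : Ctx} {n : ℕ} {A : Ty} (M : Term) (B : Ty) (N : Term) :
      MemT Γ n A → MemT (snocE Γ M B N) n A

/-- `p : φ ∈ Γ` for the proof variable with index `n`; the proposition is weakened when a term
variable declared after `p` is passed. -/
inductive MemP : Ctx → ℕ → Term → Prop
  | here (Γ : Ctx) (φ : Term) : MemP (snocP Γ φ) 0 φ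
  | skipT {Γ : Ctx} {n : ℕ} {φ : Term} (B : Ty) : MemP Γ n φ → MemP (snocT Γ B) n φ.shift
  | skipP {Γ : Ctx} {n : ℕ} {φ : Term} (ψ : Term) : MemP Γ n φ → MemP (snocP Γ ψ) (n + 1) φ
  | skipE {Γ : Ctx} {n : ℕ} {φ : Term} (M : Term) (B : Ty) (N : Term) :
      MemP Γ n φ → MemP (snocE Γ M B N) n φ

/-- `e : M =_A N ∈ Γ` for the path variable with index `n`; the endpoints are weakened when a
term variable declared after `e` is passed. -/
inductive MemE : Ctx → ℕ → Term → Ty → Term → Prop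
  | here (Γ : Ctx) (M : Term) (A : Ty) (N : Term) : MemE (snocE Γ M A N) 0 M A N
  | skipT {Γ : Ctx} {n : ℕ} {M : Term} {A : Ty} {N : Term} (B : Ty) :
      MemE Γ n M A N → MemE (snocT Γ B) n M.shift A N.shift
  | skipP {Γ : Ctx} {n : ℕ} {M : Term} {A : Ty} {N : Term} (ψ : Term) :
      MemE Γ n M A N → MemE (snocP Γ ψ) n M A N
  | skipE {Γ : Ctx} {n : ℕ} {M : Term} {A : Ty} {N : Term} (M' : Term) (B : Ty) (N' : Term) :
      MemE Γ n M A N → MemE (snocE Γ M' B N') (n + 1) M A N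

end Ctx

/-- Judgements: `Γ ⊢ valid`, `Γ ⊢ M : A`, `Γ ⊢ δ : φ`, `Γ ⊢ P : M =_A N`. -/
inductive Judgement : Type
  | valid : Ctx → Judgement
  | term : Ctx → Term → Ty → Judgement
  | proof : Ctx → Proof → Term → Judgement
  | path : Ctx → Path → Term → Ty → Term → Judgement

open Judgement in
/-- The derivable judgements of PHOML: one constructor for each rule of deduction. -/
inductive Derivable : Judgement → Prop
  | ctxNil : Derivable (valid Ctx.nil)
  | ctxT {Γ : Ctx} (A : Ty) : Derivable (valid Γ) → Derivable (valid (Γ.snocT A))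
  | ctxP {Γ : Ctx} {φ : Term} :
      Derivable (term Γ φ Ty.Omega) → Derivable (valid (Γ.snocP φ))
  | ctxE {Γ : Ctx} {M N : Term} {A : Ty} :
      Derivable (term Γ M A) → Derivable (term Γ N A) → Derivable (valid (Γ.snocE M A N))
  | varT {Γ : Ctx} {n : ℕ} {A : Ty} :
      Derivable (valid Γ) → Γ.MemT n A → Derivable (term Γ (Term.var n) A)
  | varP {Γ : Ctx} {n : ℕ} {φ : Term} :
      Derivable (valid Γ) → Γ.MemP n φ → Derivable (proof Γ (Proof.var n) φ)
  | varE {Γ : Ctx} {n : ℕ} {M : Term} {A : Ty} {N : Term} :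
      Derivable (valid Γ) → Γ.MemE n M A N → Derivable (path Γ (Path.var n) M A N)
  | bot {Γ : Ctx} : Derivable (valid Γ) → Derivable (term Γ Term.bot Ty.Omega)
  | imp {Γ : Ctx} {φ ψ : Term} :
      Derivable (term Γ φ Ty.Omega) → Derivable (term Γ ψ Ty.Omega) →
      Derivable (term Γ (Term.imp φ ψ) Ty.Omega)
  | appT {Γ : Ctx} {M N : Term} {A B : Ty} :
      Derivable (term Γ M (Ty.arrow A B)) → Derivable (term Γ N A) →
      Derivable (term Γ (Term.app M N) B)
  | lamT {Γ : Ctx} {M : Term} {A B : Ty} :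
      Derivable (term (Γ.snocT A) M B) → Derivable (term Γ (Term.lam A M) (Ty.arrow A B))
  | appP {Γ : Ctx} {δ ε : Proof} {φ ψ : Term} :
      Derivable (proof Γ δ (Term.imp φ ψ)) → Derivable (proof Γ ε φ) →
      Derivable (proof Γ (Proof.app δ ε) ψ)
  | lamP {Γ : Ctx} {δ : Proof} {φ ψ : Term} :
      Derivable (proof (Γ.snocP φ) δ ψ) →
      Derivable (proof Γ (Proof.lam φ δ) (Term.imp φ ψ))
  | convP {Γ : Ctx} {δ : Proof} {φ ψ : Term} :
      Derivable (proof Γ δ φ) → Derivable (term Γ ψ Ty.Omega) → Term.Conv φ ψ →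
      Derivable (proof Γ δ ψ)
  | ref {Γ : Ctx} {M : Term} {A : Ty} :
      Derivable (term Γ M A) → Derivable (path Γ (Path.ref M) M A M)
  | impStar {Γ : Ctx} {P Q : Path} {φ φ' ψ ψ' : Term} :
      Derivable (path Γ P φ Ty.Omega φ') → Derivable (path Γ Q ψ Ty.Omega ψ') →
      Derivable (path Γ (Path.imp P Q) (Term.imp φ ψ) Ty.Omega (Term.imp φ' ψ'))
  | univ {Γ : Ctx} {δ ε : Proof} {φ ψ : Term} :
      Derivable (proof Γ δ (Term.imp φ ψ)) → Derivable (proof Γ ε (Term.imp ψ φ)) →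
      Derivable (path Γ (Path.univ φ ψ δ ε) φ Ty.Omega ψ)
  | plus {Γ : Ctx} {P : Path} {φ ψ : Term} :
      Derivable (path Γ P φ Ty.Omega ψ) → Derivable (proof Γ (Proof.plus P) (Term.imp φ ψ))
  | minus {Γ : Ctx} {P : Path} {φ ψ : Term} :
      Derivable (path Γ P φ Ty.Omega ψ) → Derivable (proof Γ (Proof.minus P) (Term.imp ψ φ))
  | tlam {Γ : Ctx} {P : Path} {M N : Term} {A B : Ty} :
      Derivable (path (((Γ.snocT A).snocT A).snocE (Term.var 1) A (Term.var 0)) P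
        (Term.app M.shift.shift (Term.var 1)) B (Term.app N.shift.shift (Term.var 0))) →
      Derivable (term Γ M (Ty.arrow A B)) → Derivable (term Γ N (Ty.arrow A B)) →
      Derivable (path Γ (Path.tlam A P) M (Ty.arrow A B) N)
  | appE {Γ : Ctx} {P Q : Path} {M M' N N' : Term} {A B : Ty} :
      Derivable (path Γ P M (Ty.arrow A B) M') → Derivable (path Γ Q N A N') →
      Derivable (term Γ N A) → Derivable (term Γ N' A) →
      Derivable (path Γ (Path.app P N N' Q) (Term.app M N) B (Term.app M' N'))
  | convE {Γ : Ctx} {P : Path} {M M' N N' : Term} {A : Ty} :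
      Derivable (path Γ P M A N) → Derivable (term Γ M' A) → Derivable (term Γ N' A) →
      Term.Conv M M' → Term.Conv N N' → Derivable (path Γ P M' A N')

end PHOML

/-!
PHOML is consistent because it holds in the full set-theoretic model of simple type theory: `Ω` is
the type `Prop`, `A → B` is the type of all functions, a proof of `φ` says that the denotation of
`φ` is true, and a path `M =_A N` says that `M` and `N` have equal denotations. In this reading
`univ` is propositional extensionality, the triple-lambda rule is function extensionality, and `⊥`
denotes `False`; soundness of the rules (`PHOML.Derivable.sound`) therefore refutes a closed proof
of `⊥`.

The point that needs care is conversion, which is defined on raw terms: a chain of conversions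
between two well-typed terms may pass through ill-typed terms, on which no sensible denotation is
preserved. Call-by-name reduction, however, has the diamond property (`Term.Red.diamond`), since
the only overlaps are reductions on the two sides of an implication. Convertible terms thus have a
common reduct, and along reductions from a well-typed term both the type
(`Term.HasTy.red`) and the denotation (`Term.Red.eval_eq`) are preserved.
-/

namespace PHOML

/-! ### Denotations of types and terms -/

/-- The set denoted by a type in the full type hierarchy over the truth values. -/
def Ty.Den : Ty → Type
  | Ty.Omega => Prop
  | Ty.arrow A B => Ty.Den A → Ty.Den B

/-- An element of each `A.Den`, used as a junk value. -/
def Ty.point : (A : Ty) → A.Den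
  | Ty.Omega => False
  | Ty.arrow _ B => fun _ => Ty.point B

/-- A value of the model: a type together with an element of its denotation. -/
abbrev Value : Type := Σ A : Ty, A.Den

namespace Value

open Classical in
/-- The element of `B.Den` carried by a value; `B.point` if the value has a type other than `B`. -/
noncomputable def cast (B : Ty) (v : Value) : B.Den :=
  if h : v.1 = B then h ▸ v.2 else B.point

@[simp] theorem cast_mk (B : Ty) (b : B.Den) : cast B ⟨B, b⟩ = b := by simp [cast]

theorem mk_cast {B : Ty} {v : Value} (h : v.1 = B) : (⟨B, cast B v⟩ : Value) = v := by
  obtain ⟨A, a⟩ := v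
  obtain rfl : A = B := h
  rw [cast_mk]

/-- A value read as a truth value. -/
def Holds (v : Value) : Prop := cast Ty.Omega v

@[simp] theorem holds_mk (p : Prop) : Holds ⟨Ty.Omega, p⟩ ↔ p := Iff.of_eq (cast_mk Ty.Omega p)

/-- The function with domain `A` and the given values. Its codomain is the type of the value at the
junk argument; the functions given by well-typed terms have values of one type. -/
noncomputable def lam (A : Ty) (g : A.Den → Value) : Value :=
  ⟨Ty.arrow A (g A.point).1, fun a => cast _ (g a)⟩

/-- Application of values; `False` if the first one is not a function. -/
noncomputable def app : Value → Value → Value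
  | ⟨Ty.arrow A B, f⟩, w => ⟨B, f (cast A w)⟩
  | ⟨Ty.Omega, _⟩, _ => ⟨Ty.Omega, False⟩

theorem ext_holds {v w : Value} (hv : v.1 = Ty.Omega) (hw : w.1 = Ty.Omega)
    (h : v.Holds ↔ w.Holds) : v = w := by
  rw [← mk_cast hv, ← mk_cast hw]
  exact congrArg (Sigma.mk Ty.Omega) (propext h)

theorem ext_app {A B : Ty} {v w : Value} (hv : v.1 = Ty.arrow A B) (hw : w.1 = Ty.arrow A B)
    (h : ∀ a : A.Den, v.app ⟨A, a⟩ = w.app ⟨A, a⟩) : v = w := by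
  obtain ⟨_, f⟩ := v
  obtain ⟨_, g⟩ := w
  cases hv
  cases hw
  congr 1
  funext a
  simpa [app] using h a

end Value

/-- Extension of an assignment to the variables by a value for the new variable `0`. -/
def scons {α : Type} (a : α) (ρ : ℕ → α) : ℕ → α
  | 0 => a
  | n + 1 => ρ n

namespace Term

/-- The value of a raw term under an assignment; ill-typed terms have junk values. -/
noncomputable def eval : (ℕ → Value) → Term → Value
  | ρ, var n => ρ n
  | _, bot => ⟨Ty.Omega, False⟩
  | ρ, imp φ ψ => ⟨Ty.Omega, (eval ρ φ).Holds → (eval ρ ψ).Holds⟩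
  | ρ, lam A M => Value.lam A fun a => eval (scons ⟨A, a⟩ ρ) M
  | ρ, app M N => (eval ρ M).app (eval ρ N)

theorem eval_rename (M : Term) : ∀ (ξ : ℕ → ℕ) (ρ : ℕ → Value),
    eval ρ (rename ξ M) = eval (fun n => ρ (ξ n)) M := by
  induction M with
  | var n => intros; rfl
  | bot => intros; rfl
  | imp φ ψ ih₁ ih₂ => intro ξ ρ; simp only [rename, eval, ih₁, ih₂]
  | app M N ih₁ ih₂ => intro ξ ρ; simp only [rename, eval, ih₁, ih₂]
  | lam A M ih =>
    intro ξ ρ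
    have h (v : Value) :
        (fun n => scons v ρ (upRen ξ n)) = scons v (fun n => ρ (ξ n)) := by
      funext n; cases n <;> rfl
    simp only [rename, eval, ih, h]

theorem eval_shift (M : Term) (ρ : ℕ → Value) :
    eval ρ M.shift = eval (fun n => ρ (n + 1)) M :=
  eval_rename M _ ρ

theorem eval_subst (M : Term) : ∀ (σ : ℕ → Term) (ρ : ℕ → Value),
    eval ρ (subst σ M) = eval (fun n => eval ρ (σ n)) M := by
  induction M with
  | var n => intros; rfl
  | bot => intros; rfl
  | imp φ ψ ih₁ ih₂ => intro σ ρ; simp only [subst, eval, ih₁, ih₂]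
  | app M N ih₁ ih₂ => intro σ ρ; simp only [subst, eval, ih₁, ih₂]
  | lam A M ih =>
    intro σ ρ
    have h (v : Value) :
        (fun n => eval (scons v ρ) (upSubst σ n)) = scons v (fun n => eval ρ (σ n)) := by
      funext n
      cases n with
      | zero => rfl
      | succ n => exact eval_shift (σ n) (scons v ρ)
    simp only [subst, eval, ih, h]

theorem eval_inst (M N : Term) (ρ : ℕ → Value) :
    eval ρ (inst M N) = eval (scons (eval ρ N) ρ) M := by
  rw [inst, eval_subst]
  congr 1
  funext n
  cases n <;> rfl

/-! ### Simple typing of terms -/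

/-- Simple typing of terms, relative to an assignment of types to all term variables. -/
inductive HasTy : (ℕ → Ty) → Term → Ty → Prop
  | var (τ : ℕ → Ty) (n : ℕ) : HasTy τ (var n) (τ n)
  | bot (τ : ℕ → Ty) : HasTy τ bot Ty.Omega
  | imp {τ : ℕ → Ty} {φ ψ : Term} :
      HasTy τ φ Ty.Omega → HasTy τ ψ Ty.Omega → HasTy τ (imp φ ψ) Ty.Omega
  | lam {τ : ℕ → Ty} {A B : Ty} {M : Term} :
      HasTy (scons A τ) M B → HasTy τ (lam A M) (Ty.arrow A B)
  | app {τ : ℕ → Ty} {A B : Ty} {M N : Term} :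
      HasTy τ M (Ty.arrow A B) → HasTy τ N A → HasTy τ (app M N) B

theorem HasTy.rename {τ : ℕ → Ty} {M : Term} {A : Ty} (h : HasTy τ M A) :
    ∀ {τ' : ℕ → Ty} {ξ : ℕ → ℕ}, (∀ n, τ' (ξ n) = τ n) → HasTy τ' (M.rename ξ) A := by
  induction h with
  | var τ n => intro τ' ξ hξ; rw [← hξ n]; exact .var τ' (ξ n)
  | bot => intros; exact .bot _
  | imp _ _ ih₁ ih₂ => intro τ' ξ hξ; exact .imp (ih₁ hξ) (ih₂ hξ)
  | app _ _ ih₁ ih₂ => intro τ' ξ hξ; exact .app (ih₁ hξ) (ih₂ hξ)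
  | lam _ ih =>
    intro τ' ξ hξ
    exact .lam (ih fun n => by cases n with
      | zero => rfl
      | succ n => exact hξ n)

theorem HasTy.shift {τ : ℕ → Ty} {M : Term} {A : Ty}
    (h : HasTy (fun n => τ (n + 1)) M A) : HasTy τ M.shift A :=
  h.rename fun _ => rfl

theorem HasTy.subst {τ : ℕ → Ty} {M : Term} {A : Ty} (h : HasTy τ M A) :
    ∀ {τ' : ℕ → Ty} {σ : ℕ → Term}, (∀ n, HasTy τ' (σ n) (τ n)) → HasTy τ' (M.subst σ) A := by
  induction h with
  | var τ n => intro τ' σ hσ; exact hσ n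
  | bot => intros; exact .bot _
  | imp _ _ ih₁ ih₂ => intro τ' σ hσ; exact .imp (ih₁ hσ) (ih₂ hσ)
  | app _ _ ih₁ ih₂ => intro τ' σ hσ; exact .app (ih₁ hσ) (ih₂ hσ)
  | @lam τ A B M _ ih =>
    intro τ' σ hσ
    exact .lam (ih fun n => by cases n with
      | zero => exact .var (scons A τ') 0
      | succ n => exact HasTy.shift (τ := scons A τ') (hσ n))

theorem HasTy.inst {τ : ℕ → Ty} {M N : Term} {A B : Ty} (hM : HasTy (scons A τ) M B)
    (hN : HasTy τ N A) : HasTy τ (M.inst N) B :=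
  hM.subst fun n => by cases n with
    | zero => exact hN
    | succ n => exact .var τ n

/-- Subject reduction. -/
theorem HasTy.red {M N : Term} (h : Red M N) :
    ∀ {τ : ℕ → Ty} {A : Ty}, HasTy τ M A → HasTy τ N A := by
  induction h with
  | beta A M N =>
    intro τ B hM
    cases hM with
    | app h₁ h₂ => cases h₁ with
      | lam h => exact h.inst h₂
  | appLeft N _ ih => intro τ B hM; cases hM with
    | app h₁ h₂ => exact .app (ih h₁) h₂
  | impLeft ψ _ ih => intro τ B hM; cases hM with
    | imp h₁ h₂ => exact .imp (ih h₁) h₂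
  | impRight φ _ ih => intro τ B hM; cases hM with
    | imp h₁ h₂ => exact .imp h₁ (ih h₂)

/-- The value of a well-typed term has the type of the term. -/
theorem HasTy.eval_fst {τ : ℕ → Ty} {M : Term} {A : Ty} (h : HasTy τ M A) :
    ∀ {ρ : ℕ → Value}, (∀ n, (ρ n).1 = τ n) → (eval ρ M).1 = A := by
  induction h with
  | var τ n => intro ρ hρ; exact hρ n
  | bot => intros; rfl
  | imp => intros; rfl
  | @app τ A B M N _ _ ih₁ _ =>
    intro ρ hρ
    have h := ih₁ hρ
    rw [eval, ← Value.mk_cast h]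
    rfl
  | @lam τ A B M _ ih =>
    intro ρ hρ
    exact congrArg (Ty.arrow A) (ih fun n => by cases n with
      | zero => rfl
      | succ n => exact hρ n)

/-! ### Reduction and convertibility -/

/-- Reduction from a well-typed term preserves the value. Typing is needed: a redex whose argument
has the wrong type is evaluated at a junk argument. -/
theorem Red.eval_eq {M N : Term} (h : Red M N) :
    ∀ {τ : ℕ → Ty} {A : Ty} {ρ : ℕ → Value}, HasTy τ M A → (∀ n, (ρ n).1 = τ n) →
      eval ρ M = eval ρ N := by
  induction h with
  | beta A M N =>
    intro τ B ρ hM hρ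
    cases hM with
    | app h₁ h₂ => cases h₁ with
      | lam h =>
        have hs (v : Value) (hv : v.1 = A) : (eval (scons v ρ) M).1 = B :=
          h.eval_fst fun n => by cases n with
            | zero => exact hv
            | succ n => exact hρ n
        have hN := h₂.eval_fst hρ
        simp only [eval, Value.lam, Value.app]
        rw [eval_inst, Value.mk_cast hN]
        exact Value.mk_cast ((hs _ hN).trans (hs _ rfl).symm)
  | appLeft N _ ih => intro τ B ρ hM hρ; cases hM with
    | app h₁ h₂ => simp only [eval, ih h₁ hρ]
  | impLeft ψ _ ih => intro τ B ρ hM hρ; cases hM with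
    | imp h₁ h₂ => simp only [eval, ih h₁ hρ]
  | impRight φ _ ih => intro τ B ρ hM hρ; cases hM with
    | imp h₁ h₂ => simp only [eval, ih h₂ hρ]

theorem Red.eval_eq_of_reflTransGen {M N : Term} (h : Relation.ReflTransGen Red M N)
    {τ : ℕ → Ty} {A : Ty} {ρ : ℕ → Value} (hM : HasTy τ M A) (hρ : ∀ n, (ρ n).1 = τ n) :
    eval ρ M = eval ρ N := by
  induction h using Relation.ReflTransGen.head_induction_on with
  | refl => rfl
  | head h _ ih => exact (h.eval_eq hM hρ).trans (ih (hM.red h))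

/-- Two different one-step reducts of a term have a common one-step reduct. -/
theorem Red.diamond {M N₁ : Term} (h₁ : Red M N₁) :
    ∀ {N₂ : Term}, Red M N₂ → N₁ = N₂ ∨ ∃ N, Red N₁ N ∧ Red N₂ N := by
  induction h₁ with
  | beta A M N =>
    intro N₂ h₂
    cases h₂ with
    | beta => exact .inl rfl
    | appLeft _ h => cases h
  | appLeft N h ih =>
    intro N₂ h₂
    cases h₂ with
    | beta => cases h
    | appLeft _ h' =>
      rcases ih h' with rfl | ⟨K, hK₁, hK₂⟩
      · exact .inl rfl
      · exact .inr ⟨_, .appLeft N hK₁, .appLeft N hK₂⟩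
  | impLeft ψ h ih =>
    intro N₂ h₂
    cases h₂ with
    | impLeft _ h' =>
      rcases ih h' with rfl | ⟨K, hK₁, hK₂⟩
      · exact .inl rfl
      · exact .inr ⟨_, .impLeft ψ hK₁, .impLeft ψ hK₂⟩
    | impRight _ h' => exact .inr ⟨_, .impRight _ h', .impLeft _ h⟩
  | impRight φ h ih =>
    intro N₂ h₂
    cases h₂ with
    | impLeft _ h' => exact .inr ⟨_, .impLeft _ h', .impRight _ h⟩
    | impRight _ h' =>
      rcases ih h' with rfl | ⟨K, hK₁, hK₂⟩
      · exact .inl rfl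
      · exact .inr ⟨_, .impRight φ hK₁, .impRight φ hK₂⟩

/-- Convertible terms have a common reduct. -/
theorem Conv.join {M N : Term} (h : Conv M N) :
    Relation.Join (Relation.ReflTransGen Red) M N := by
  have hequiv : Equivalence (Relation.Join (Relation.ReflTransGen Red)) :=
    Relation.equivalence_join_reflTransGen fun _ _ _ h₁ h₂ => by
      rcases h₁.diamond h₂ with rfl | ⟨K, hK₁, hK₂⟩
      · exact ⟨_, .refl, .refl⟩
      · exact ⟨K, .single hK₁, .single hK₂⟩
  induction h with
  | rel _ _ h => exact ⟨_, .single h, .refl⟩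
  | refl M => exact hequiv.refl M
  | symm _ _ _ ih => exact hequiv.symm ih
  | trans _ _ _ _ _ ih₁ ih₂ => exact hequiv.trans ih₁ ih₂

theorem Conv.eval_eq {M N : Term} (h : Conv M N) {τ : ℕ → Ty} {A B : Ty} {ρ : ℕ → Value}
    (hM : HasTy τ M A) (hN : HasTy τ N B) (hρ : ∀ n, (ρ n).1 = τ n) : eval ρ M = eval ρ N := by
  obtain ⟨K, hMK, hNK⟩ := h.join
  exact (Red.eval_eq_of_reflTransGen hMK hM hρ).trans
    (Red.eval_eq_of_reflTransGen hNK hN hρ).symm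

end Term

/-! ### Soundness of the rules -/

namespace Ctx

/-- The assignment `τ` of types gives the term variables of `Γ` their declared types. -/
def Fits : Ctx → (ℕ → Ty) → Prop
  | nil, _ => True
  | snocT Γ A, τ => τ 0 = A ∧ Fits Γ fun n => τ (n + 1)
  | snocP Γ _, τ => Fits Γ τ
  | snocE Γ _ _ _, τ => Fits Γ τ

/-- The propositions and the endpoints of paths declared in `Γ` are well-typed. -/
def WF : Ctx → Prop
  | nil => True
  | snocT Γ _ => WF Γ
  | snocP Γ φ => WF Γ ∧ ∀ τ, Γ.Fits τ → φ.HasTy τ Ty.Omega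
  | snocE Γ M A N => WF Γ ∧ ∀ τ, Γ.Fits τ → M.HasTy τ A ∧ N.HasTy τ A

/-- The assignment `ρ` of values satisfies the equations and the propositions declared in `Γ`. -/
def Sat : Ctx → (ℕ → Value) → Prop
  | nil, _ => True
  | snocT Γ _, ρ => Sat Γ fun n => ρ (n + 1)
  | snocP Γ φ, ρ => Sat Γ ρ ∧ (φ.eval ρ).Holds
  | snocE Γ M _ N, ρ => Sat Γ ρ ∧ M.eval ρ = N.eval ρ

theorem MemT.eq_of_fits {Γ : Ctx} {n : ℕ} {A : Ty} (h : Γ.MemT n A) :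
    ∀ {τ : ℕ → Ty}, Γ.Fits τ → τ n = A := by
  induction h with
  | here => intro τ hτ; exact hτ.1
  | skipT _ _ ih => intro τ hτ; exact ih hτ.2
  | skipP _ _ ih => intro τ hτ; exact ih hτ
  | skipE _ _ _ _ ih => intro τ hτ; exact ih hτ

theorem MemP.hasTy {Γ : Ctx} {n : ℕ} {φ : Term} (h : Γ.MemP n φ) :
    Γ.WF → ∀ {τ : ℕ → Ty}, Γ.Fits τ → φ.HasTy τ Ty.Omega := by
  induction h with
  | here => intro hΓ τ hτ; exact hΓ.2 τ hτ
  | skipT _ _ ih => intro hΓ τ hτ; exact (ih hΓ hτ.2).shift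
  | skipP _ _ ih => intro hΓ τ hτ; exact ih hΓ.1 hτ
  | skipE _ _ _ _ ih => intro hΓ τ hτ; exact ih hΓ.1 hτ

theorem MemP.holds {Γ : Ctx} {n : ℕ} {φ : Term} (h : Γ.MemP n φ) :
    ∀ {ρ : ℕ → Value}, Γ.Sat ρ → (φ.eval ρ).Holds := by
  induction h with
  | here => intro ρ hρ; exact hρ.2
  | skipT _ _ ih => intro ρ hρ; rw [Term.eval_shift]; exact ih hρ
  | skipP _ _ ih => intro ρ hρ; exact ih hρ.1
  | skipE _ _ _ _ ih => intro ρ hρ; exact ih hρ.1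

theorem MemE.hasTy {Γ : Ctx} {n : ℕ} {M N : Term} {A : Ty} (h : Γ.MemE n M A N) :
    Γ.WF → ∀ {τ : ℕ → Ty}, Γ.Fits τ → M.HasTy τ A ∧ N.HasTy τ A := by
  induction h with
  | here => intro hΓ τ hτ; exact hΓ.2 τ hτ
  | skipT _ _ ih => intro hΓ τ hτ; exact ⟨(ih hΓ hτ.2).1.shift, (ih hΓ hτ.2).2.shift⟩
  | skipP _ _ ih => intro hΓ τ hτ; exact ih hΓ.1 hτ
  | skipE _ _ _ _ ih => intro hΓ τ hτ; exact ih hΓ.1 hτ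

theorem MemE.eval_eq {Γ : Ctx} {n : ℕ} {M N : Term} {A : Ty} (h : Γ.MemE n M A N) :
    ∀ {ρ : ℕ → Value}, Γ.Sat ρ → M.eval ρ = N.eval ρ := by
  induction h with
  | here => intro ρ hρ; exact hρ.2
  | skipT _ _ ih => intro ρ hρ; rw [Term.eval_shift, Term.eval_shift]; exact ih hρ
  | skipP _ _ ih => intro ρ hρ; exact ih hρ.1
  | skipE _ _ _ _ ih => intro ρ hρ; exact ih hρ.1

end Ctx

/-- The meaning of a judgement in the model. Typing is required under every assignment of types
that fits the context, and not only where the context is satisfied, so that `φ ⊃ ψ` is seen to be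
well-typed even if `φ` is false. -/
def Judgement.Sound : Judgement → Prop
  | valid Γ => Γ.WF
  | term Γ M A => Γ.WF ∧ ∀ τ, Γ.Fits τ → M.HasTy τ A
  | proof Γ _ φ => Γ.WF ∧ ∀ τ, Γ.Fits τ → φ.HasTy τ Ty.Omega ∧
      ∀ ρ : ℕ → Value, (∀ n, (ρ n).1 = τ n) → Γ.Sat ρ → (φ.eval ρ).Holds
  | path Γ _ M A N => Γ.WF ∧ ∀ τ, Γ.Fits τ → (M.HasTy τ A ∧ N.HasTy τ A) ∧
      ∀ ρ : ℕ → Value, (∀ n, (ρ n).1 = τ n) → Γ.Sat ρ → M.eval ρ = N.eval ρ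

/-- Every derivable judgement holds in the model. -/
theorem Derivable.sound {J : Judgement} (h : Derivable J) : J.Sound := by
  induction h with
  | ctxNil => trivial
  | ctxT A _ ih => exact ih
  | ctxP _ ih => exact ih
  | ctxE _ _ ih₁ ih₂ => exact ⟨ih₁.1, fun τ hτ => ⟨ih₁.2 τ hτ, ih₂.2 τ hτ⟩⟩
  | varT _ hn ih =>
    exact ⟨ih, fun τ hτ => hn.eq_of_fits hτ ▸ .var τ _⟩
  | varP _ hn ih =>
    exact ⟨ih, fun τ hτ => ⟨hn.hasTy ih hτ, fun _ _ hρ => hn.holds hρ⟩⟩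
  | varE _ hn ih =>
    exact ⟨ih, fun τ hτ => ⟨hn.hasTy ih hτ, fun _ _ hρ => hn.eval_eq hρ⟩⟩
  | bot _ ih => exact ⟨ih, fun τ _ => .bot τ⟩
  | imp _ _ ih₁ ih₂ => exact ⟨ih₁.1, fun τ hτ => .imp (ih₁.2 τ hτ) (ih₂.2 τ hτ)⟩
  | appT _ _ ih₁ ih₂ => exact ⟨ih₁.1, fun τ hτ => .app (ih₁.2 τ hτ) (ih₂.2 τ hτ)⟩
  | lamT _ ih => exact ⟨ih.1, fun τ hτ => .lam (ih.2 _ ⟨rfl, hτ⟩)⟩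
  | appP _ _ ih₁ ih₂ =>
    refine ⟨ih₁.1, fun τ hτ => ?_⟩
    obtain ⟨ht, hv⟩ := ih₁.2 τ hτ
    cases ht with
    | imp _ hψ =>
      exact ⟨hψ, fun ρ hρ hs => (Value.holds_mk _).1 (hv ρ hρ hs) ((ih₂.2 τ hτ).2 ρ hρ hs)⟩
  | lamP _ ih =>
    refine ⟨ih.1.1, fun τ hτ => ⟨.imp (ih.1.2 τ hτ) (ih.2 τ hτ).1, fun ρ hρ hs => ?_⟩⟩
    exact (Value.holds_mk _).2 fun hφ => (ih.2 τ hτ).2 ρ hρ ⟨hs, hφ⟩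
  | convP _ _ hc ih₁ ih₂ =>
    refine ⟨ih₁.1, fun τ hτ => ⟨ih₂.2 τ hτ, fun ρ hρ hs => ?_⟩⟩
    rw [← hc.eval_eq (ih₁.2 τ hτ).1 (ih₂.2 τ hτ) hρ]
    exact (ih₁.2 τ hτ).2 ρ hρ hs
  | ref _ ih => exact ⟨ih.1, fun τ hτ => ⟨⟨ih.2 τ hτ, ih.2 τ hτ⟩, fun _ _ _ => rfl⟩⟩
  | impStar _ _ ih₁ ih₂ =>
    refine ⟨ih₁.1, fun τ hτ => ?_⟩
    obtain ⟨⟨h₁, h₁'⟩, e₁⟩ := ih₁.2 τ hτ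
    obtain ⟨⟨h₂, h₂'⟩, e₂⟩ := ih₂.2 τ hτ
    exact ⟨⟨.imp h₁ h₂, .imp h₁' h₂'⟩, fun ρ hρ hs => by
      simp only [Term.eval, e₁ ρ hρ hs, e₂ ρ hρ hs]⟩
  | univ _ _ ih₁ ih₂ =>
    refine ⟨ih₁.1, fun τ hτ => ?_⟩
    obtain ⟨ht, hv⟩ := ih₁.2 τ hτ
    cases ht with
    | imp hφ hψ =>
      exact ⟨⟨hφ, hψ⟩, fun ρ hρ hs => Value.ext_holds (hφ.eval_fst hρ) (hψ.eval_fst hρ)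
        ⟨(Value.holds_mk _).1 (hv ρ hρ hs),
          (Value.holds_mk _).1 ((ih₂.2 τ hτ).2 ρ hρ hs)⟩⟩
  | plus _ ih =>
    refine ⟨ih.1, fun τ hτ => ?_⟩
    obtain ⟨⟨hφ, hψ⟩, e⟩ := ih.2 τ hτ
    exact ⟨.imp hφ hψ, fun ρ hρ hs => (Value.holds_mk _).2 fun h => e ρ hρ hs ▸ h⟩
  | minus _ ih =>
    refine ⟨ih.1, fun τ hτ => ?_⟩
    obtain ⟨⟨hφ, hψ⟩, e⟩ := ih.2 τ hτ
    exact ⟨.imp hψ hφ, fun ρ hρ hs => (Value.holds_mk _).2 fun h => (e ρ hρ hs).symm ▸ h⟩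
  | @tlam Γ P M N A B _ _ _ ih₁ ih₂ ih₃ =>
    refine ⟨ih₂.1, fun τ hτ => ⟨⟨ih₂.2 τ hτ, ih₃.2 τ hτ⟩, fun ρ hρ hs => ?_⟩⟩
    refine Value.ext_app ((ih₂.2 τ hτ).eval_fst hρ) ((ih₃.2 τ hτ).eval_fst hρ) fun a => ?_
    -- Both bound variables take the value `a`, so that the hypothesis `x =_A y` is satisfied.
    have key := (ih₁.2 (scons A (scons A τ)) ⟨rfl, rfl, hτ⟩).2 (scons ⟨A, a⟩ (scons ⟨A, a⟩ ρ))
      (fun n => match n with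
        | 0 => rfl
        | 1 => rfl
        | n + 2 => hρ n)
      ⟨hs, rfl⟩
    simpa only [Term.eval, Term.eval_shift, scons] using key
  | appE _ _ _ _ ih₁ ih₂ _ _ =>
    refine ⟨ih₁.1, fun τ hτ => ?_⟩
    obtain ⟨⟨h₁, h₁'⟩, e₁⟩ := ih₁.2 τ hτ
    obtain ⟨⟨h₂, h₂'⟩, e₂⟩ := ih₂.2 τ hτ
    exact ⟨⟨.app h₁ h₂, .app h₁' h₂'⟩, fun ρ hρ hs => by
      simp only [Term.eval, e₁ ρ hρ hs, e₂ ρ hρ hs]⟩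
  | convE _ _ _ hc₁ hc₂ ih₁ ih₂ ih₃ =>
    refine ⟨ih₁.1, fun τ hτ => ⟨⟨ih₂.2 τ hτ, ih₃.2 τ hτ⟩, fun ρ hρ hs => ?_⟩⟩
    obtain ⟨⟨h, h'⟩, e⟩ := ih₁.2 τ hτ
    rw [← hc₁.eval_eq h (ih₂.2 τ hτ) hρ, ← hc₂.eval_eq h' (ih₃.2 τ hτ) hρ]
    exact e ρ hρ hs

end PHOML

theorem mainTheorem4 :
    ¬ ∃ δ : PHOML.Proof,
      PHOML.Derivable (PHOML.Judgement.proof PHOML.Ctx.nil δ PHOML.Term.bot) := by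
  rintro ⟨δ, h⟩
  exact (PHOML.Value.holds_mk False).1
    ((h.sound.2 (fun _ => PHOML.Ty.Omega) trivial).2 (fun _ => ⟨PHOML.Ty.Omega, False⟩)
      (fun _ => rfl) trivial)
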